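/- Let $(W,S)$ be a finite Coxeter system with length function $\ell$. The right weak order on $W$ is the partial order generated by the relations $ws<w$ for $w\in W$ and $s\in S$ with $\ell(ws)<\ell(w)$. Let $K\subseteq S$ and let $W_K$ be the subgroup of $W$ generated by $K$. For $w\in W$, let $w_K$ be the element $u\in W_K$ with $\ell(u)+\ell(u^{-1}w)=\ell(w)$ for which $\ell(u)$ is largest. Then $w_K$ is well defined (there is exactly one such $u$), the right weak order on $W$ is a lattice, and the fibers of the map $w\mapsto w_K$ are the classes of a lattice congruence of the right weak order on $W$, namely the smallest lattice congruence (with respect to inclusion of relations) in which $1\equiv s$ for every $s\in S-K$. -/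

import Mathlib

namespace CoxeterSystem

/-- The set `S` of simple reflections of a Coxeter system `(W, S)`. -/
def simpleReflections {B W : Type*} [Group W] {M : CoxeterMatrix B} (cs : CoxeterSystem M W) :
    Set W :=
  Set.range cs.simple

/-- The relations `w s ⋖ w`, for `w` in `W` and a right descent `s` of `w`, which generate the
right weak order: `cs.WeakCover u w` says that `u = w s` for some right descent `s` of `w`. -/
def WeakCover {B W : Type*} [Group W] {M : CoxeterMatrix B} (cs : CoxeterSystem M W)
    (u w : W) : Prop :=
  ∃ i : B, cs.IsRightDescent w i ∧ u = w * cs.simple i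

/-- The right weak order, as a relation: the reflexive transitive closure of `WeakCover`. -/
def WeakLE {B W : Type*} [Group W] {M : CoxeterMatrix B} (cs : CoxeterSystem M W)
    (u w : W) : Prop :=
  Relation.ReflTransGen cs.WeakCover u w

theorem WeakCover.length_lt {B W : Type*} [Group W] {M : CoxeterMatrix B}
    {cs : CoxeterSystem M W} {u w : W} (h : cs.WeakCover u w) : cs.length u < cs.length w := by
  obtain ⟨i, hi, rfl⟩ := h
  exact hi

theorem WeakLE.eq_or_length_lt {B W : Type*} [Group W] {M : CoxeterMatrix B}
    {cs : CoxeterSystem M W} {u w : W} (h : cs.WeakLE u w) :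
    u = w ∨ cs.length u < cs.length w := by
  induction h with
  | refl => exact Or.inl rfl
  | tail _ hc ih =>
    rcases ih with rfl | ih
    · exact Or.inr hc.length_lt
    · exact Or.inr (ih.trans hc.length_lt)

/-- The right weak order on `W`. -/
@[reducible]
def weakOrder {B W : Type*} [Group W] {M : CoxeterMatrix B} (cs : CoxeterSystem M W) :
    PartialOrder W where
  le := cs.WeakLE
  le_refl _ := Relation.ReflTransGen.refl
  le_trans _ _ _ h h' := Relation.ReflTransGen.trans h h'
  le_antisymm u w h h' := by
    rcases WeakLE.eq_or_length_lt h with h1 | h1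
    · exact h1
    · rcases WeakLE.eq_or_length_lt h' with h2 | h2
      · exact h2.symm
      · exact absurd h1 h2.asymm

/-- `cs.IsParabolicPrefix K w u`: the element `u` lies in the parabolic subgroup `W_K` generated
by `K`, and the factorization `w = u * (u⁻¹ * w)` is length-additive. -/
def IsParabolicPrefix {B W : Type*} [Group W] {M : CoxeterMatrix B} (cs : CoxeterSystem M W)
    (K : Set W) (w u : W) : Prop :=
  u ∈ Subgroup.closure K ∧ cs.length u + cs.length (u⁻¹ * w) = cs.length w

/-- `u` is the left factor of a factorization of `w` which maximizes the length of the left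
factor among all length-additive factorizations of `w` with left factor in `W_K`. -/
def IsParabolicFactor {B W : Type*} [Group W] {M : CoxeterMatrix B} (cs : CoxeterSystem M W)
    (K : Set W) (w u : W) : Prop :=
  cs.IsParabolicPrefix K w u ∧ ∀ v, cs.IsParabolicPrefix K w v → cs.length v ≤ cs.length u

theorem exists_isParabolicFactor {B W : Type*} [Group W] {M : CoxeterMatrix B}
    (cs : CoxeterSystem M W) (K : Set W) (w : W) : ∃ u, cs.IsParabolicFactor K w u := by
  classical
  let P : ℕ → Prop := fun n => ∃ u, cs.IsParabolicPrefix K w u ∧ cs.length u = n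
  have hP : P 0 := ⟨1, ⟨Subgroup.one_mem _, by simp⟩, by simp⟩
  obtain ⟨u, hu, hn⟩ := Nat.findGreatest_spec (P := P) (Nat.zero_le (cs.length w)) hP
  refine ⟨u, hu, fun v hv => ?_⟩
  rw [hn]
  exact Nat.le_findGreatest (by have := hv.2; omega) ⟨v, hv, rfl⟩

/-- The parabolic projection `w ↦ w_K`. -/
noncomputable def parabolicProj {B W : Type*} [Group W] {M : CoxeterMatrix B}
    (cs : CoxeterSystem M W) (K : Set W) (w : W) : W :=
  (cs.exists_isParabolicFactor K w).choose

end CoxeterSystem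

namespace CoxeterSystem

/-! ### The inversion cocycle -/

/-! Everything rests on the left inversions of an element: the inversions of `x * y` are those of
`x` symmetric-differenced with the `x`-conjugates of those of `y` (`isLeftInversion_mul_iff`). This
comes from a signed action of `W` on `W × ZMod 2`, and it yields the exchange property and the
length-additive factorization of `w` through a shortest representative of its right coset of `W_K`.

Hence `w_K` can be read in two ways. It is the greatest element of `W_K` below `w`, so its fibers
respect meets (`parabolicProj_eq_iff_weakLE`). Its inversions are those of `w` lying in `W_K`, so
its fibers respect right multiplication by the longest element `w₀`, which complements inversion
sets (`parabolicProj_mul_longest`). That multiplication reverses the order, so joins are dual to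
meets and the fibers respect them too. Meets exist because common lower bounds are directed
(`exists_weakLE_of_lower_bounds`).

For minimality, let `v₀` be the longest element of `W_K`. A congruence with `1 ≡ s` for all `s`
outside `K` satisfies `v₀ ≡ w₀`. Meeting with `w` gives `w_K = w ⊓ v₀ ≡ w ⊓ w₀ = w`. -/

open Classical in
/-- The signed conjugation action of a simple reflection on `W × ZMod 2`, flipping the sign of
the reflection itself. -/
noncomputable def signedConj {B W : Type*} [Group W] {M : CoxeterMatrix B}
    (cs : CoxeterSystem M W) (i : B) : Function.End (W × ZMod 2) :=
  fun p => (cs.simple i * p.1 * cs.simple i, p.2 + if p.1 = cs.simple i then 1 else 0)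

-- The letters of the alternating word flip the sign exactly at the reflections `q⁻ʳ sⱼ` with `q =
-- sᵢ sⱼ` and `r < 2k`, counted with multiplicity.
open Classical in
theorem signedConj_mul_pow_apply {B W : Type*} [Group W] {M : CoxeterMatrix B}
    (cs : CoxeterSystem M W) (i j : B) (k : ℕ) (t : W) (e : ZMod 2) :
    ((cs.signedConj i * cs.signedConj j) ^ k : Function.End (W × ZMod 2)) (t, e) =
      ((cs.simple i * cs.simple j) ^ k * t * ((cs.simple i * cs.simple j) ^ k)⁻¹,
        e + ∑ r ∈ Finset.range (2 * k),
          if t = ((cs.simple i * cs.simple j) ^ r)⁻¹ * cs.simple j then 1 else 0) := by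
  set q := cs.simple i * cs.simple j with hq
  have hqj : ∀ r : ℕ, cs.simple j * q ^ r = (q ^ r)⁻¹ * cs.simple j := by
    intro r
    have h : cs.simple j * q * (cs.simple j)⁻¹ = q⁻¹ := by simp [hq, mul_assoc]
    have h' : cs.simple j * q ^ r * (cs.simple j)⁻¹ = (q ^ r)⁻¹ := by
      rw [← conj_pow, h, inv_pow]
    rw [← h']; group
  induction k with
  | zero => simp; rfl
  | succ k ih =>
    have e1 : (q ^ k * t * (q ^ k)⁻¹ = cs.simple j) ↔
        t = (q ^ (2 * k))⁻¹ * cs.simple j := by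
      have : (q ^ k)⁻¹ * cs.simple j * q ^ k = (q ^ (2 * k))⁻¹ * cs.simple j := by
        rw [mul_assoc, hqj, two_mul, pow_add]; group
      rw [← this]
      constructor
      · intro h; rw [← h]; group
      · rintro rfl; group
    have e2 : (cs.simple j * (q ^ k * t * (q ^ k)⁻¹) * cs.simple j = cs.simple i) ↔
        t = (q ^ (2 * k + 1))⁻¹ * cs.simple j := by
      have : (q ^ k)⁻¹ * (cs.simple j * cs.simple i * cs.simple j) * q ^ k =
          (q ^ (2 * k + 1))⁻¹ * cs.simple j := by
        have h : cs.simple j * cs.simple i = q⁻¹ := by simp [hq]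
        rw [h, mul_assoc, mul_assoc, hqj, two_mul, pow_succ, pow_add]; group
      rw [← this]
      constructor
      · intro h; rw [← h]; simp [mul_assoc]
      · rintro rfl; simp [mul_assoc]
    rw [pow_succ']
    change cs.signedConj i (cs.signedConj j
      (((cs.signedConj i * cs.signedConj j) ^ k : Function.End (W × ZMod 2)) (t, e))) = _
    rw [ih]
    simp only [signedConj, e1, e2]
    rw [show 2 * (k + 1) = 2 * k + 1 + 1 by ring, Finset.sum_range_succ, Finset.sum_range_succ]
    refine Prod.ext ?_ ?_
    · simp only [pow_succ', hq, mul_inv_rev, inv_simple, mul_assoc]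
    · simp only [add_assoc]

theorem isLiftable_signedConj {B W : Type*} [Group W] {M : CoxeterMatrix B}
    (cs : CoxeterSystem M W) : M.IsLiftable cs.signedConj := by
  classical
  intro i j
  funext ⟨t, e⟩
  -- For `k = M i j` the power `q ^ k` is trivial, so the indices `r` and `r + k` name the same
  -- reflection and the flips cancel in pairs.
  rw [signedConj_mul_pow_apply, simple_mul_simple_pow, two_mul, Finset.sum_range_add]
  simp only [pow_add, simple_mul_simple_pow, one_mul, inv_one, mul_one]
  rw [CharTwo.add_self_eq_zero, add_zero]
  rfl

/-- The parity with which `t` occurs in the right inversion sequence of a word for `w`. -/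
noncomputable def inversionParity {B W : Type*} [Group W] {M : CoxeterMatrix B}
    (cs : CoxeterSystem M W) (w t : W) : ZMod 2 :=
  (cs.lift ⟨cs.signedConj, cs.isLiftable_signedConj⟩ w (t, 0)).2

theorem lift_signedConj_apply {B W : Type*} [Group W] {M : CoxeterMatrix B}
    (cs : CoxeterSystem M W) (w t : W) (e : ZMod 2) :
    cs.lift ⟨cs.signedConj, cs.isLiftable_signedConj⟩ w (t, e) =
      (w * t * w⁻¹, e + cs.inversionParity w t) := by
  unfold inversionParity
  induction w using cs.simple_induction_left generalizing t e with
  | one =>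
    rw [map_one]
    change (t, e) = (1 * t * 1⁻¹, e + 0)
    simp
  | mul_simple_left w i ih =>
    rw [map_mul]
    change cs.lift ⟨cs.signedConj, cs.isLiftable_signedConj⟩ (cs.simple i)
      (cs.lift ⟨cs.signedConj, cs.isLiftable_signedConj⟩ w (t, e)) = (_, e +
      (cs.lift ⟨cs.signedConj, cs.isLiftable_signedConj⟩ (cs.simple i)
      (cs.lift ⟨cs.signedConj, cs.isLiftable_signedConj⟩ w (t, 0))).2)
    rw [ih t e, ih t 0, lift_apply_simple]
    simp [signedConj, mul_assoc, add_assoc]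

theorem inversionParity_mul {B W : Type*} [Group W] {M : CoxeterMatrix B}
    (cs : CoxeterSystem M W) (x y t : W) :
    cs.inversionParity (x * y) t =
      cs.inversionParity y t + cs.inversionParity x (y * t * y⁻¹) := by
  have h : cs.lift ⟨cs.signedConj, cs.isLiftable_signedConj⟩ (x * y) (t, 0) =
      cs.lift ⟨cs.signedConj, cs.isLiftable_signedConj⟩ x
        (cs.lift ⟨cs.signedConj, cs.isLiftable_signedConj⟩ y (t, 0)) := by
    rw [map_mul]; rfl
  rw [lift_signedConj_apply, lift_signedConj_apply, lift_signedConj_apply] at h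
  simpa using congrArg Prod.snd h

theorem inversionParity_one {B W : Type*} [Group W] {M : CoxeterMatrix B}
    (cs : CoxeterSystem M W) (t : W) : cs.inversionParity 1 t = 0 := by
  rw [inversionParity, map_one]
  rfl

open Classical in
theorem inversionParity_simple {B W : Type*} [Group W] {M : CoxeterMatrix B}
    (cs : CoxeterSystem M W) (i : B) (t : W) :
    cs.inversionParity (cs.simple i) t = if t = cs.simple i then 1 else 0 := by
  simp [inversionParity, lift_apply_simple, signedConj]

theorem mem_rightInvSeq_of_inversionParity_ne_zero {B W : Type*} [Group W] {M : CoxeterMatrix B}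
    (cs : CoxeterSystem M W) (ω : List B) (t : W)
    (h : cs.inversionParity (cs.wordProd ω) t ≠ 0) : t ∈ cs.rightInvSeq ω := by
  classical
  induction ω with
  | nil => simp [inversionParity_one] at h
  | cons i ω ih =>
    rw [wordProd_cons, inversionParity_mul, inversionParity_simple] at h
    rw [rightInvSeq, List.mem_cons]
    by_cases hi : cs.wordProd ω * t * (cs.wordProd ω)⁻¹ = cs.simple i
    · left; rw [← hi]; group
    · right; apply ih; simpa [hi] using h

theorem isRightInversion_of_inversionParity_ne_zero {B W : Type*} [Group W] {M : CoxeterMatrix B}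
    (cs : CoxeterSystem M W) {w t : W} (h : cs.inversionParity w t ≠ 0) :
    cs.IsRightInversion w t := by
  obtain ⟨ω, hω, rfl⟩ := cs.exists_isReduced w
  exact cs.isRightInversion_of_mem_rightInvSeq hω
    (cs.mem_rightInvSeq_of_inversionParity_ne_zero ω t h)

theorem IsReflection.inversionParity_self {B W : Type*} [Group W] {M : CoxeterMatrix B}
    {cs : CoxeterSystem M W} {t : W} (ht : cs.IsReflection t) : cs.inversionParity t t = 1 := by
  obtain ⟨u, i, rfl⟩ := ht
  have h := cs.inversionParity_mul u u⁻¹ (u * cs.simple i * u⁻¹)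
  rw [mul_inv_cancel, inversionParity_one] at h
  rw [inversionParity_mul, inversionParity_mul, inversionParity_simple]
  have e : u⁻¹ * (u * cs.simple i * u⁻¹) * u⁻¹⁻¹ = cs.simple i := by group
  rw [e] at h ⊢
  rw [if_pos rfl, mul_inv_cancel_right, add_left_comm, ← h, add_zero]

/-- For the forward direction: if the parity at `w` vanished, the cocycle rule would give parity `1`
at `w * t`, making `t` an inversion of `w * t` and so not of `w`. -/
theorem isRightInversion_iff_inversionParity {B W : Type*} [Group W] {M : CoxeterMatrix B}
    (cs : CoxeterSystem M W) {w t : W} :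
    cs.IsRightInversion w t ↔ cs.inversionParity w t ≠ 0 := by
  refine ⟨fun h h0 => ?_, cs.isRightInversion_of_inversionParity_ne_zero⟩
  have ht := h.1
  refine (ht.isRightInversion_mul_left_iff (w := w)).1 ?_ h
  apply cs.isRightInversion_of_inversionParity_ne_zero
  rw [inversionParity_mul, ht.inversionParity_self, mul_inv_cancel_right, h0]
  decide

theorem isRightInversion_mul_iff {B W : Type*} [Group W] {M : CoxeterMatrix B}
    (cs : CoxeterSystem M W) {x y t : W} :
    cs.IsRightInversion (x * y) t ↔
      (cs.IsRightInversion y t ↔ ¬ cs.IsRightInversion x (y * t * y⁻¹)) := by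
  simp only [isRightInversion_iff_inversionParity, inversionParity_mul]
  generalize cs.inversionParity y t = a
  generalize cs.inversionParity x (y * t * y⁻¹) = b
  revert a b
  decide

/-- The left inversions of a product `x * y` are the symmetric difference of the left inversions
of `x` and the conjugates by `x` of the left inversions of `y`. -/
theorem isLeftInversion_mul_iff {B W : Type*} [Group W] {M : CoxeterMatrix B}
    (cs : CoxeterSystem M W) {x y t : W} :
    cs.IsLeftInversion (x * y) t ↔
      (cs.IsLeftInversion x t ↔ ¬ cs.IsLeftInversion y (x⁻¹ * t * x)) := by
  simp only [← isRightInversion_inv_iff, mul_inv_rev]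
  rw [isRightInversion_mul_iff, inv_inv]

/-- This is the strong exchange property: a reflection that shortens the product of a word does so
by deleting one of its letters. -/
theorem mem_leftInvSeq_of_isLeftInversion {B W : Type*} [Group W] {M : CoxeterMatrix B}
    (cs : CoxeterSystem M W) (ω : List B) (t : W)
    (h : cs.IsLeftInversion (cs.wordProd ω) t) : t ∈ cs.leftInvSeq ω := by
  induction ω generalizing t with
  | nil => simp [IsLeftInversion] at h
  | cons i ω ih =>
    rw [wordProd_cons, isLeftInversion_mul_iff] at h
    rw [leftInvSeq, List.mem_cons, List.mem_map]
    by_cases hi : cs.IsLeftInversion (cs.simple i) t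
    · left
      have h1 := hi.2
      rw [length_simple, Nat.lt_one_iff, length_eq_zero_iff] at h1
      rw [← inv_simple, ← mul_eq_one_iff_eq_inv]
      exact h1
    · right
      refine ⟨_, ih _ (not_not.1 fun h' => hi (h.2 h')), ?_⟩
      simp [mul_assoc]

end CoxeterSystem

namespace CoxeterSystem

/-! ### The weak order and length-additive factorizations -/

theorem weakLE_mul_of_length_mul {B W : Type*} [Group W] {M : CoxeterMatrix B}
    (cs : CoxeterSystem M W) (u z : W)
    (h : cs.length (u * z) = cs.length u + cs.length z) : cs.WeakLE u (u * z) := by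
  induction hn : cs.length z generalizing z with
  | zero =>
    rw [length_eq_zero_iff] at hn
    rw [hn, mul_one]
    exact Relation.ReflTransGen.refl
  | succ n ih =>
    have hz : z ≠ 1 := by rintro rfl; simp at hn
    obtain ⟨i, hi⟩ := cs.exists_rightDescent_of_ne_one hz
    rw [isRightDescent_iff] at hi
    have h1 := cs.length_mul_le u (z * cs.simple i)
    have h2 := cs.length_mul_simple (u * z) i
    rw [mul_assoc] at h2
    refine Relation.ReflTransGen.tail (ih (z * cs.simple i) (by omega) (by omega)) ⟨i, ?_, ?_⟩
    · rw [IsRightDescent, mul_assoc]; omega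
    · rw [mul_assoc]

theorem weakLE_iff {B W : Type*} [Group W] {M : CoxeterMatrix B}
    (cs : CoxeterSystem M W) {u w : W} :
    cs.WeakLE u w ↔ cs.length u + cs.length (u⁻¹ * w) = cs.length w := by
  constructor
  · intro h
    induction h with
    | refl => simp
    | @tail b c _ hc ih =>
      obtain ⟨i, hi, rfl⟩ := hc
      rw [isRightDescent_iff] at hi
      have h1 := cs.length_mul_le u (u⁻¹ * c)
      rw [mul_inv_cancel_left] at h1
      have h2 := cs.length_mul_simple (u⁻¹ * c) i
      rw [mul_assoc] at h2
      omega
  · intro h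
    have := cs.weakLE_mul_of_length_mul u (u⁻¹ * w) (by rw [mul_inv_cancel_left]; exact h.symm)
    rwa [mul_inv_cancel_left] at this

theorem WeakLE.trans {B W : Type*} [Group W] {M : CoxeterMatrix B}
    {cs : CoxeterSystem M W} {u v w : W} (h : cs.WeakLE u v) (h' : cs.WeakLE v w) :
    cs.WeakLE u w :=
  Relation.ReflTransGen.trans h h'

theorem WeakLE.length_le {B W : Type*} [Group W] {M : CoxeterMatrix B}
    {cs : CoxeterSystem M W} {u w : W} (h : cs.WeakLE u w) : cs.length u ≤ cs.length w := by
  rcases h.eq_or_length_lt with rfl | h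
  · exact le_rfl
  · exact h.le

theorem WeakLE.eq_of_length_le {B W : Type*} [Group W] {M : CoxeterMatrix B}
    {cs : CoxeterSystem M W} {u w : W} (h : cs.WeakLE u w) (hl : cs.length w ≤ cs.length u) :
    u = w :=
  h.eq_or_length_lt.resolve_right hl.not_gt

theorem one_weakLE {B W : Type*} [Group W] {M : CoxeterMatrix B}
    (cs : CoxeterSystem M W) (w : W) : cs.WeakLE 1 w := by
  simp [weakLE_iff]

theorem simple_weakLE_iff {B W : Type*} [Group W] {M : CoxeterMatrix B}
    (cs : CoxeterSystem M W) {i : B} {w : W} :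
    cs.WeakLE (cs.simple i) w ↔ cs.IsLeftDescent w i := by
  rw [weakLE_iff, isLeftDescent_iff, length_simple, inv_simple, add_comm]

/-- Left multiplication by `m` identifies the weak order above `1` with the weak order above `m`,
on length-additive products. -/
theorem weakLE_mul_mul_of_weakLE {B W : Type*} [Group W] {M : CoxeterMatrix B}
    (cs : CoxeterSystem M W) {m y z : W}
    (hz : cs.length (m * z) = cs.length m + cs.length z) (h : cs.WeakLE y z) :
    cs.WeakLE (m * y) (m * z) := by
  rw [weakLE_iff] at h ⊢
  have e : (m * y)⁻¹ * (m * z) = y⁻¹ * z := by group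
  rw [e]
  have h1 := cs.length_mul_le m y
  have h2 := cs.length_mul_le (m * y) (y⁻¹ * z)
  rw [mul_assoc, mul_inv_cancel_left] at h2
  omega

theorem length_mul_of_weakLE {B W : Type*} [Group W] {M : CoxeterMatrix B}
    (cs : CoxeterSystem M W) {m y z : W}
    (hz : cs.length (m * z) = cs.length m + cs.length z) (h : cs.WeakLE y z) :
    cs.length (m * y) = cs.length m + cs.length y := by
  rw [weakLE_iff] at h
  have h1 := cs.length_mul_le m y
  have h2 := cs.length_mul_le (m * y) (y⁻¹ * z)
  rw [mul_assoc, mul_inv_cancel_left] at h2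
  omega

theorem weakLE_of_mul_weakLE_mul {B W : Type*} [Group W] {M : CoxeterMatrix B}
    (cs : CoxeterSystem M W) {m y z : W}
    (hy : cs.length (m * y) = cs.length m + cs.length y)
    (hz : cs.length (m * z) = cs.length m + cs.length z)
    (h : cs.WeakLE (m * y) (m * z)) : cs.WeakLE y z := by
  rw [weakLE_iff] at h ⊢
  have e : (m * y)⁻¹ * (m * z) = y⁻¹ * z := by group
  rw [e] at h
  omega

/-! ### Parabolic subgroups -/

/-- Every element of a parabolic subgroup has a reduced word in the generators of the
subgroup. -/
theorem exists_isReduced_of_mem_closure {B W : Type*} [Group W] {M : CoxeterMatrix B}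
    (cs : CoxeterSystem M W) {K : Set W} (hK : K ⊆ cs.simpleReflections) {v : W}
    (hv : v ∈ Subgroup.closure K) :
    ∃ ω : List B, cs.IsReduced ω ∧ (∀ i ∈ ω, cs.simple i ∈ K) ∧ v = cs.wordProd ω := by
  have step : ∀ s ∈ K, ∀ y : W,
      (∃ ω : List B, cs.IsReduced ω ∧ (∀ i ∈ ω, cs.simple i ∈ K) ∧ y = cs.wordProd ω) →
      ∃ ω : List B, cs.IsReduced ω ∧ (∀ i ∈ ω, cs.simple i ∈ K) ∧ s * y = cs.wordProd ω := by
    rintro s hs y ⟨ω, hω, hωK, rfl⟩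
    obtain ⟨i, rfl⟩ := hK hs
    by_cases hd : cs.IsLeftDescent (cs.wordProd ω) i
    -- By exchange, a shortening generator erases a letter of `ω`, so no letter outside `K` enters.
    · have hm := cs.mem_leftInvSeq_of_isLeftInversion ω _
        ((cs.isLeftInversion_simple_iff_isLeftDescent _ i).2 hd)
      obtain ⟨j, hj, hji⟩ := List.mem_iff_getElem.1 hm
      have he := cs.getD_leftInvSeq_mul_wordProd ω j
      rw [List.getD_eq_getElem _ _ hj, hji] at he
      rw [length_leftInvSeq] at hj
      refine ⟨ω.eraseIdx j, ?_, fun k hk => hωK k (List.mem_of_mem_eraseIdx hk), he⟩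
      rw [isLeftDescent_iff, he, hω.eq, ← List.length_eraseIdx_add_one hj] at hd
      exact Nat.add_right_cancel hd
    · refine ⟨i :: ω, ?_, ?_, (cs.wordProd_cons i ω).symm⟩
      · rw [not_isLeftDescent_iff, ← wordProd_cons, hω.eq] at hd
        exact hd
      · intro k hk
        rcases List.mem_cons.1 hk with rfl | hk
        · exact hs
        · exact hωK k hk
  induction hv using Subgroup.closure_induction_left with
  | one => exact ⟨[], by simp [IsReduced], by simp, by simp⟩
  | mul_left s hs y _ ih => exact step s hs y ih
  | inv_mul_cancel s hs y _ ih =>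
    obtain ⟨i, rfl⟩ := hK hs
    rw [inv_simple]
    exact step _ hs y ih

theorem simple_mem_of_mem_closure {B W : Type*} [Group W] {M : CoxeterMatrix B}
    (cs : CoxeterSystem M W) {K : Set W} (hK : K ⊆ cs.simpleReflections) {i : B}
    (hi : cs.simple i ∈ Subgroup.closure K) : cs.simple i ∈ K := by
  obtain ⟨ω, hω, hωK, he⟩ := cs.exists_isReduced_of_mem_closure hK hi
  have hl := hω.eq
  rw [← he, length_simple, eq_comm, List.length_eq_one_iff] at hl
  obtain ⟨j, rfl⟩ := hl
  rw [he, wordProd_singleton]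
  exact hωK j (by simp)

theorem mem_closure_of_isLeftInversion {B W : Type*} [Group W] {M : CoxeterMatrix B}
    (cs : CoxeterSystem M W) {K : Set W} (hK : K ⊆ cs.simpleReflections) {v t : W}
    (hv : v ∈ Subgroup.closure K) (ht : cs.IsLeftInversion v t) : t ∈ Subgroup.closure K := by
  obtain ⟨ω, -, hωK, rfl⟩ := cs.exists_isReduced_of_mem_closure hK hv
  clear hv
  induction ω generalizing t with
  | nil => simp [IsLeftInversion] at ht
  | cons i ω ih =>
    have hi : cs.simple i ∈ Subgroup.closure K := Subgroup.subset_closure (hωK i (by simp))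
    rw [wordProd_cons, isLeftInversion_mul_iff] at ht
    by_cases h : cs.IsLeftInversion (cs.simple i) t
    · have h1 := h.2
      rw [length_simple, Nat.lt_one_iff, length_eq_zero_iff, mul_eq_one_iff_eq_inv,
        inv_simple] at h1
      rwa [h1]
    · have h1 := ih (fun k hk => hωK k (by simp [hk])) (not_not.1 fun h' => h (ht.2 h'))
      have h2 := mul_mem (mul_mem hi h1) (inv_mem hi)
      simpa [mul_assoc] using h2

theorem mem_closure_of_weakLE {B W : Type*} [Group W] {M : CoxeterMatrix B}
    (cs : CoxeterSystem M W) {K : Set W} (hK : K ⊆ cs.simpleReflections) {u v : W}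
    (hv : v ∈ Subgroup.closure K) (h : cs.WeakLE u v) : u ∈ Subgroup.closure K := by
  induction h using Relation.ReflTransGen.head_induction_on with
  | refl => exact hv
  | head hc _ ih =>
    obtain ⟨i, hi, rfl⟩ := hc
    rename_i c _
    -- The cover is left multiplication by the reflection `c s c⁻¹`, an inversion of `c` and hence
    -- an element of `W_K`.
    have h1 : cs.IsLeftInversion c (c * cs.simple i * c⁻¹) := by
      refine ⟨(cs.isReflection_simple i).conj c, ?_⟩
      simpa [IsRightDescent] using hi
    have h2 := mul_mem (cs.mem_closure_of_isLeftInversion hK ih h1) ih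
    simpa using h2

theorem exists_isLeftDescent_of_mem_closure {B W : Type*} [Group W] {M : CoxeterMatrix B}
    (cs : CoxeterSystem M W) {K : Set W} (hK : K ⊆ cs.simpleReflections) {v : W}
    (hv : v ∈ Subgroup.closure K) (h1 : v ≠ 1) :
    ∃ i, cs.simple i ∈ K ∧ cs.IsLeftDescent v i := by
  obtain ⟨i, hi⟩ := cs.exists_leftDescent_of_ne_one h1
  exact ⟨i, cs.simple_mem_of_mem_closure hK (cs.mem_closure_of_isLeftInversion hK hv
    ((cs.isLeftInversion_simple_iff_isLeftDescent _ i).2 hi)), hi⟩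

/-- Length is additive on products of an element of `W_K` and a shortest representative of a
right coset of `W_K`. -/
theorem length_mul_of_forall_length_le {B W : Type*} [Group W] {M : CoxeterMatrix B}
    (cs : CoxeterSystem M W) {K : Set W} (hK : K ⊆ cs.simpleReflections) {r : W}
    (hr : ∀ x ∈ Subgroup.closure K, cs.length r ≤ cs.length (x * r)) {v : W}
    (hv : v ∈ Subgroup.closure K) : cs.length (v * r) = cs.length v + cs.length r := by
  obtain ⟨ω, hω, hωK, rfl⟩ := cs.exists_isReduced_of_mem_closure hK hv
  clear hv
  induction ω with
  | nil => simp
  | cons i ω ih =>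
    have hω' : cs.IsReduced ω := by simpa using hω.drop 1
    have hωK' : ∀ k ∈ ω, cs.simple k ∈ K := fun k hk => hωK k (by simp [hk])
    have hmem : cs.wordProd ω ∈ Subgroup.closure K := by
      apply Subgroup.list_prod_mem
      intro x hx
      obtain ⟨k, hk, rfl⟩ := List.mem_map.1 hx
      exact Subgroup.subset_closure (hωK' k hk)
    have ih := ih hω' hωK'
    have hnd : ¬ cs.IsLeftDescent (cs.wordProd ω) i := by
      rw [not_isLeftDescent_iff, ← wordProd_cons, hω.eq, hω'.eq, List.length_cons]
    have hnd' : ¬ cs.IsLeftDescent (cs.wordProd ω * r) i := by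
      -- A new descent would come from an inversion of `r` lying in `W_K`, which would shorten `r`
      -- inside its coset.
      intro h
      rw [← isLeftInversion_simple_iff_isLeftDescent] at h hnd
      rw [isLeftInversion_mul_iff] at h
      have h1 := (not_not.1 fun h' => hnd (h.2 h')).2
      refine absurd (hr _ ?_) h1.not_ge
      exact mul_mem (mul_mem (inv_mem hmem) (Subgroup.subset_closure (hωK i (by simp)))) hmem
    rw [not_isLeftDescent_iff] at hnd hnd'
    rw [wordProd_cons, mul_assoc, hnd', hnd, ih]
    omega

/-- Each `w` factors through `W_K` in such a way that length is additive on the whole coset. -/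
theorem exists_parabolic_factorization {B W : Type*} [Group W] {M : CoxeterMatrix B}
    (cs : CoxeterSystem M W) {K : Set W} (hK : K ⊆ cs.simpleReflections) (w : W) :
    ∃ v ∈ Subgroup.closure K, ∀ x ∈ Subgroup.closure K,
      cs.length (x * w) = cs.length (x * v) + cs.length (v⁻¹ * w) := by
  classical
  let P : ℕ → Prop := fun n => ∃ v ∈ Subgroup.closure K, cs.length (v⁻¹ * w) = n
  have hP : ∃ n, P n := ⟨_, 1, one_mem _, rfl⟩
  obtain ⟨v, hv, hn⟩ := Nat.find_spec hP
  refine ⟨v, hv, fun x hx => ?_⟩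
  have := cs.length_mul_of_forall_length_le hK (r := v⁻¹ * w) (fun y hy => ?_) (mul_mem hx hv)
  · rw [← this]; congr 1; group
  · rw [hn]
    apply Nat.find_min' hP
    refine ⟨v * y⁻¹, mul_mem hv (inv_mem hy), ?_⟩
    congr 1; group

/-- The greatest element of `W_K` below `w` in the weak order. -/
theorem exists_greatest_prefix {B W : Type*} [Group W] {M : CoxeterMatrix B}
    (cs : CoxeterSystem M W) {K : Set W} (hK : K ⊆ cs.simpleReflections) (w : W) :
    ∃ v ∈ Subgroup.closure K, cs.WeakLE v w ∧
      (∀ u ∈ Subgroup.closure K, cs.WeakLE u w ↔ cs.WeakLE u v) ∧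
      ∀ t ∈ Subgroup.closure K, cs.IsLeftInversion w t ↔ cs.IsLeftInversion v t := by
  obtain ⟨v, hv, h⟩ := cs.exists_parabolic_factorization hK w
  have h1 := h 1 (one_mem _)
  rw [one_mul, one_mul] at h1
  refine ⟨v, hv, cs.weakLE_iff.2 h1.symm, fun u hu => ?_, fun t ht => ?_⟩
  -- Additivity on the whole coset is used at `x = u⁻¹` for the order and at `x = t` for the
  -- inversions.
  · rw [weakLE_iff, weakLE_iff, h _ (inv_mem hu), h1]
    omega
  · rw [IsLeftInversion, IsLeftInversion, h t ht, h1]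
    simp

theorem parabolicProj_spec {B W : Type*} [Group W] {M : CoxeterMatrix B}
    (cs : CoxeterSystem M W) (K : Set W) (w : W) :
    cs.IsParabolicFactor K w (cs.parabolicProj K w) :=
  (cs.exists_isParabolicFactor K w).choose_spec

theorem isParabolicPrefix_iff {B W : Type*} [Group W] {M : CoxeterMatrix B}
    (cs : CoxeterSystem M W) {K : Set W} {w u : W} :
    cs.IsParabolicPrefix K w u ↔ u ∈ Subgroup.closure K ∧ cs.WeakLE u w := by
  rw [IsParabolicPrefix, weakLE_iff]

theorem IsParabolicFactor.eq_of_greatest {B W : Type*} [Group W] {M : CoxeterMatrix B}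
    {cs : CoxeterSystem M W} {K : Set W} {w u v : W} (h : cs.IsParabolicFactor K w u)
    (hv : v ∈ Subgroup.closure K) (hvw : cs.WeakLE v w)
    (hmax : ∀ x ∈ Subgroup.closure K, cs.WeakLE x w ↔ cs.WeakLE x v) : u = v := by
  have h1 := cs.isParabolicPrefix_iff.1 h.1
  exact ((hmax u h1.1).1 h1.2).eq_of_length_le (h.2 v (cs.isParabolicPrefix_iff.2 ⟨hv, hvw⟩))

theorem isParabolicFactor_iff {B W : Type*} [Group W] {M : CoxeterMatrix B}
    (cs : CoxeterSystem M W) {K : Set W} (hK : K ⊆ cs.simpleReflections) (w u : W) :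
    cs.IsParabolicFactor K w u ↔ u = cs.parabolicProj K w := by
  constructor
  · intro h
    obtain ⟨v, hv, hvw, hmax, -⟩ := cs.exists_greatest_prefix hK w
    rw [h.eq_of_greatest hv hvw hmax, (cs.parabolicProj_spec K w).eq_of_greatest hv hvw hmax]
  · rintro rfl
    exact cs.parabolicProj_spec K w

theorem parabolicProj_mem {B W : Type*} [Group W] {M : CoxeterMatrix B}
    (cs : CoxeterSystem M W) (K : Set W) (w : W) :
    cs.parabolicProj K w ∈ Subgroup.closure K :=
  (cs.parabolicProj_spec K w).1.1

theorem parabolicProj_weakLE {B W : Type*} [Group W] {M : CoxeterMatrix B}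
    (cs : CoxeterSystem M W) (K : Set W) (w : W) : cs.WeakLE (cs.parabolicProj K w) w :=
  (cs.isParabolicPrefix_iff.1 (cs.parabolicProj_spec K w).1).2

theorem weakLE_iff_weakLE_parabolicProj {B W : Type*} [Group W] {M : CoxeterMatrix B}
    (cs : CoxeterSystem M W) {K : Set W} (hK : K ⊆ cs.simpleReflections) {w u : W}
    (hu : u ∈ Subgroup.closure K) : cs.WeakLE u w ↔ cs.WeakLE u (cs.parabolicProj K w) := by
  obtain ⟨v, hv, hvw, hmax, -⟩ := cs.exists_greatest_prefix hK w
  rw [(cs.parabolicProj_spec K w).eq_of_greatest hv hvw hmax]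
  exact hmax u hu

theorem isLeftInversion_parabolicProj_iff {B W : Type*} [Group W] {M : CoxeterMatrix B}
    (cs : CoxeterSystem M W) {K : Set W} (hK : K ⊆ cs.simpleReflections) {w t : W} :
    cs.IsLeftInversion (cs.parabolicProj K w) t ↔
      t ∈ Subgroup.closure K ∧ cs.IsLeftInversion w t := by
  obtain ⟨v, hv, hvw, hmax, hinv⟩ := cs.exists_greatest_prefix hK w
  rw [(cs.parabolicProj_spec K w).eq_of_greatest hv hvw hmax]
  constructor
  · intro h
    have ht := cs.mem_closure_of_isLeftInversion hK hv h
    exact ⟨ht, (hinv t ht).2 h⟩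
  · rintro ⟨ht, h⟩
    exact (hinv t ht).1 h

/-- An element is determined by its left inversions. -/
theorem eq_of_isLeftInversion_iff {B W : Type*} [Group W] {M : CoxeterMatrix B}
    (cs : CoxeterSystem M W) {x y : W}
    (h : ∀ t, cs.IsLeftInversion x t ↔ cs.IsLeftInversion y t) : x = y := by
  rw [← inv_mul_eq_one]
  by_contra hne
  obtain ⟨i, hi⟩ := cs.exists_leftDescent_of_ne_one hne
  rw [← isLeftInversion_simple_iff_isLeftDescent] at hi
  -- The descent `s` of `x⁻¹ * y` makes `x s x⁻¹` an inversion of exactly one of `x` and `y`.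
  have h1 := cs.isLeftInversion_mul_iff (x := x) (y := x⁻¹ * y) (t := x * cs.simple i * x⁻¹)
  have e : x⁻¹ * (x * cs.simple i * x⁻¹) * x = cs.simple i := by group
  rw [mul_inv_cancel_left, e, ← h] at h1
  tauto

theorem parabolicProj_eq_iff {B W : Type*} [Group W] {M : CoxeterMatrix B}
    (cs : CoxeterSystem M W) {K : Set W} (hK : K ⊆ cs.simpleReflections) {x y : W} :
    cs.parabolicProj K x = cs.parabolicProj K y ↔
      ∀ t ∈ Subgroup.closure K, cs.IsLeftInversion x t ↔ cs.IsLeftInversion y t := by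
  constructor
  · intro h t ht
    have h1 := cs.isLeftInversion_parabolicProj_iff hK (w := x) (t := t)
    have h2 := cs.isLeftInversion_parabolicProj_iff hK (w := y) (t := t)
    rw [h] at h1
    tauto
  · intro h
    apply cs.eq_of_isLeftInversion_iff
    intro t
    rw [isLeftInversion_parabolicProj_iff _ hK, isLeftInversion_parabolicProj_iff _ hK]
    exact and_congr_right (h t)

end CoxeterSystem

namespace CoxeterSystem

/-! ### Longest elements -/

/-- In a finite Coxeter group, each parabolic subgroup has an element which has every reflection
of the subgroup as a left inversion. -/
theorem exists_forall_isLeftInversion {B W : Type*} [Group W] [Finite W] {M : CoxeterMatrix B}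
    (cs : CoxeterSystem M W) (K : Set W) :
    ∃ v ∈ Subgroup.closure K,
      ∀ t ∈ Subgroup.closure K, cs.IsReflection t → cs.IsLeftInversion v t := by
  obtain ⟨v, hv, hmax⟩ := Set.exists_max_image (Subgroup.closure K : Set W) cs.length
    (Set.toFinite _) ⟨1, one_mem _⟩
  -- A reflection always changes the length, so at an element of maximal length it must lower it.
  exact ⟨v, hv, fun t ht hr =>
    ⟨hr, (hmax _ (mul_mem ht hv)).lt_of_ne (hr.length_mul_right_ne v)⟩⟩

/-- A left descent `s` of `v * v₀` cannot exist: `s` is inverted by `v` and `v⁻¹ s v` by `v₀`, so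
the two cancel in the symmetric difference. -/
theorem eq_inv_of_forall_isLeftDescent {B W : Type*} [Group W] {M : CoxeterMatrix B}
    (cs : CoxeterSystem M W) {K : Set W} (hK : K ⊆ cs.simpleReflections) {v₀ v : W}
    (hv₀ : v₀ ∈ Subgroup.closure K)
    (hinv : ∀ t ∈ Subgroup.closure K, cs.IsReflection t → cs.IsLeftInversion v₀ t)
    (hv : v ∈ Subgroup.closure K)
    (hdesc : ∀ i, cs.simple i ∈ K → cs.IsLeftDescent v i) : v = v₀⁻¹ := by
  rw [← mul_eq_one_iff_eq_inv]
  by_contra hne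
  obtain ⟨i, hiK, hi⟩ := cs.exists_isLeftDescent_of_mem_closure hK (mul_mem hv hv₀) hne
  have hiv := hdesc i hiK
  rw [← isLeftInversion_simple_iff_isLeftDescent] at hi hiv
  rw [isLeftInversion_mul_iff] at hi
  refine hi.1 hiv (hinv _ ?_ ?_)
  · exact mul_mem (mul_mem (inv_mem hv) (Subgroup.subset_closure hiK)) hv
  · simpa using (cs.isReflection_simple i).conj v⁻¹

theorem weakLE_of_mem_closure {B W : Type*} [Group W] {M : CoxeterMatrix B}
    (cs : CoxeterSystem M W) {K : Set W} (hK : K ⊆ cs.simpleReflections) {v₀ x : W}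
    (hinv : ∀ t ∈ Subgroup.closure K, cs.IsReflection t → cs.IsLeftInversion v₀ t)
    (hx : x ∈ Subgroup.closure K) : cs.WeakLE x v₀ := by
  induction hn : cs.length x generalizing x with
  | zero =>
    rw [length_eq_zero_iff] at hn
    rw [hn]
    exact cs.one_weakLE v₀
  | succ n ih =>
    have hx1 : x ≠ 1 := by rintro rfl; simp at hn
    obtain ⟨i, hi⟩ := cs.exists_rightDescent_of_ne_one hx1
    have hxi : x * cs.simple i ∈ Subgroup.closure K :=
      cs.mem_closure_of_weakLE hK hx (Relation.ReflTransGen.single ⟨i, hi, rfl⟩)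
    rw [isRightDescent_iff] at hi
    have h := ih hxi (by omega)
    have ht : x * cs.simple i * x⁻¹ ∈ Subgroup.closure K := mul_mem hxi (inv_mem hx)
    have hinv' := hinv _ ht ((cs.isReflection_simple i).conj x)
    have hmul := cs.isLeftInversion_mul_iff (x := x * cs.simple i)
      (y := (x * cs.simple i)⁻¹ * v₀) (t := x * cs.simple i * x⁻¹)
    have e : (x * cs.simple i)⁻¹ * (x * cs.simple i * x⁻¹) * (x * cs.simple i) =
      cs.simple i := by simp [mul_assoc]
    rw [e, mul_inv_cancel_left] at hmul
    have hnot : ¬ cs.IsLeftInversion (x * cs.simple i) (x * cs.simple i * x⁻¹) := by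
      intro h'
      have := h'.2
      simp only [mul_assoc, inv_mul_cancel_left, simple_mul_simple_self,
        mul_one] at this
      omega
    -- The reflection `x s x⁻¹` is inverted by `v₀` but not by `x s`, so the prefix `x s` of `v₀`
    -- extends by `s` to `x`.
    have hz : cs.IsLeftInversion ((x * cs.simple i)⁻¹ * v₀) (cs.simple i) := by tauto
    rw [isLeftInversion_simple_iff_isLeftDescent, isLeftDescent_iff] at hz
    have e' : cs.simple i * ((x * cs.simple i)⁻¹ * v₀) = x⁻¹ * v₀ := by simp [mul_assoc]
    rw [e'] at hz
    rw [weakLE_iff] at h ⊢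
    omega

/-! ### Meets in the weak order -/

/-- After cancelling `m`, the part of an upper bound in the rank-two parabolic subgroup has both
generators as descents, so it is the longest element there. The witness `d` thus does not depend on
`x`, which allows it to be used below two elements at once. -/
theorem exists_join_of_covers {B W : Type*} [Group W] [Finite W] {M : CoxeterMatrix B}
    (cs : CoxeterSystem M W) {m : W} {i j : B} (hi : ¬ cs.IsRightDescent m i)
    (hj : ¬ cs.IsRightDescent m j) :
    ∃ d, ∀ x, cs.WeakLE (m * cs.simple i) x → cs.WeakLE (m * cs.simple j) x →
      cs.WeakLE (m * cs.simple i) d ∧ cs.WeakLE (m * cs.simple j) d ∧ cs.WeakLE d x := by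
  have hK : ({cs.simple i, cs.simple j} : Set W) ⊆ cs.simpleReflections := by
    rintro _ (rfl | rfl)
    exacts [⟨i, rfl⟩, ⟨j, rfl⟩]
  obtain ⟨v₀, hv₀, hinv⟩ := cs.exists_forall_isLeftInversion {cs.simple i, cs.simple j}
  refine ⟨m * v₀⁻¹, fun x hix hjx => ?_⟩
  rw [not_isRightDescent_iff, ← cs.length_simple i] at hi
  rw [not_isRightDescent_iff, ← cs.length_simple j] at hj
  have hmx := (cs.weakLE_mul_of_length_mul m _ hi).trans hix
  rw [weakLE_iff] at hmx
  obtain ⟨z, rfl⟩ : ∃ z, x = m * z := ⟨m⁻¹ * x, by group⟩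
  rw [inv_mul_cancel_left] at hmx
  obtain ⟨v, hv, hvz, hmax, -⟩ := cs.exists_greatest_prefix hK z
  have hiv := (hmax _ (Subgroup.subset_closure (by simp))).1
    (cs.weakLE_of_mul_weakLE_mul hi hmx.symm hix)
  have hjv := (hmax _ (Subgroup.subset_closure (by simp))).1
    (cs.weakLE_of_mul_weakLE_mul hj hmx.symm hjx)
  have hvv : v = v₀⁻¹ := by
    refine cs.eq_inv_of_forall_isLeftDescent hK hv₀ hinv hv fun k hk => ?_
    rw [← simple_weakLE_iff]
    rcases hk with hk | hk <;> rw [hk] <;> assumption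
  rw [← hvv]
  have hmv := cs.length_mul_of_weakLE hmx.symm hvz
  exact ⟨cs.weakLE_mul_mul_of_weakLE hmv hiv, cs.weakLE_mul_mul_of_weakLE hmv hjv,
    cs.weakLE_mul_mul_of_weakLE hmx.symm hvz⟩

theorem WeakLE.eq_or_exists_simple {B W : Type*} [Group W] {M : CoxeterMatrix B}
    {cs : CoxeterSystem M W} {m u : W} (h : cs.WeakLE m u) :
    m = u ∨ ∃ i, ¬ cs.IsRightDescent m i ∧ cs.WeakLE (m * cs.simple i) u := by
  rcases Relation.ReflTransGen.cases_head h with h | ⟨c, ⟨i, hi, rfl⟩, hc⟩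
  · exact Or.inl h
  · refine Or.inr ⟨i, ?_, ?_⟩
    · exact cs.isRightDescent_iff_not_isRightDescent_mul.1 hi
    · rwa [simple_mul_simple_cancel_right]

/-- The set of lower bounds of two elements is directed in the weak order. -/
theorem exists_weakLE_of_lower_bounds {B W : Type*} [Group W] [Finite W] {M : CoxeterMatrix B}
    (cs : CoxeterSystem M W) {x y : W} (m u v : W) (hmu : cs.WeakLE m u) (hmv : cs.WeakLE m v)
    (hux : cs.WeakLE u x) (huy : cs.WeakLE u y) (hvx : cs.WeakLE v x) (hvy : cs.WeakLE v y) :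
    ∃ a, cs.WeakLE u a ∧ cs.WeakLE v a ∧ cs.WeakLE a x ∧ cs.WeakLE a y := by
  induction hn : cs.length x - cs.length m using Nat.strong_induction_on generalizing m u v with
  | _ n ih =>
    rcases hmu.eq_or_exists_simple with rfl | ⟨i, hi, hiu⟩
    · exact ⟨v, hmv, Relation.ReflTransGen.refl, hvx, hvy⟩
    rcases hmv.eq_or_exists_simple with rfl | ⟨j, hj, hjv⟩
    · exact ⟨u, Relation.ReflTransGen.refl, hmu, hux, huy⟩
    obtain ⟨d, hd⟩ := cs.exists_join_of_covers hi hj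
    obtain ⟨hid, hjd, hdx⟩ := hd x (hiu.trans hux) (hjv.trans hvx)
    obtain ⟨-, -, hdy⟩ := hd y (hiu.trans huy) (hjv.trans hvy)
    have hix := (hiu.trans hux).length_le
    have hjx := (hjv.trans hvx).length_le
    rw [not_isRightDescent_iff] at hi hj
    -- First bound `u` and `d` above `m sᵢ`, then that bound and `v` above `m sⱼ`; both base points
    -- are longer than `m`.
    obtain ⟨a, hua, hda, hax, hay⟩ :=
      ih _ (by omega) (m * cs.simple i) u d hiu hid hux huy hdx hdy rfl
    obtain ⟨b, hab, hvb, hbx, hby⟩ :=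
      ih _ (by omega) (m * cs.simple j) a v (hjd.trans hda) hjv hax hay hvx hvy rfl
    exact ⟨b, hua.trans hab, hvb, hbx, hby⟩

theorem exists_weak_meet {B W : Type*} [Group W] [Finite W] {M : CoxeterMatrix B}
    (cs : CoxeterSystem M W) (x y : W) :
    ∃ z, ∀ u, cs.WeakLE u z ↔ cs.WeakLE u x ∧ cs.WeakLE u y := by
  obtain ⟨z, ⟨hzx, hzy⟩, hmax⟩ := Set.exists_max_image {u | cs.WeakLE u x ∧ cs.WeakLE u y}
    cs.length (Set.toFinite _) ⟨1, cs.one_weakLE x, cs.one_weakLE y⟩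
  refine ⟨z, fun u => ⟨fun h => ⟨h.trans hzx, h.trans hzy⟩, fun ⟨hux, huy⟩ => ?_⟩⟩
  obtain ⟨a, hza, hua, hax, hay⟩ := cs.exists_weakLE_of_lower_bounds 1 z u (cs.one_weakLE z)
    (cs.one_weakLE u) hzx hzy hux huy
  rwa [hza.eq_of_length_le (hmax a ⟨hax, hay⟩)]

/-! ### Multiplication by the longest element -/

theorem closure_simpleReflections {B W : Type*} [Group W] {M : CoxeterMatrix B}
    (cs : CoxeterSystem M W) : Subgroup.closure cs.simpleReflections = ⊤ :=
  cs.subgroup_closure_range_simple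

theorem exists_longest {B W : Type*} [Group W] [Finite W] {M : CoxeterMatrix B}
    (cs : CoxeterSystem M W) : ∃ w₀ : W, ∀ t, cs.IsReflection t → cs.IsLeftInversion w₀ t := by
  obtain ⟨w₀, -, h⟩ := cs.exists_forall_isLeftInversion cs.simpleReflections
  exact ⟨w₀, fun t ht => h t (by simp [closure_simpleReflections]) ht⟩

theorem eq_inv_longest {B W : Type*} [Group W] {M : CoxeterMatrix B}
    (cs : CoxeterSystem M W) {w₀ v : W} (h₀ : ∀ t, cs.IsReflection t → cs.IsLeftInversion w₀ t)
    (hv : ∀ i, cs.IsLeftDescent v i) : v = w₀⁻¹ :=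
  cs.eq_inv_of_forall_isLeftDescent subset_rfl (by simp [closure_simpleReflections])
    (fun t _ ht => h₀ t ht) (by simp [closure_simpleReflections]) fun i _ => hv i

theorem longest_inv {B W : Type*} [Group W] {M : CoxeterMatrix B}
    (cs : CoxeterSystem M W) {w₀ : W} (h₀ : ∀ t, cs.IsReflection t → cs.IsLeftInversion w₀ t) :
    w₀⁻¹ = w₀ :=
  (cs.eq_inv_longest h₀ fun i => (cs.isLeftInversion_simple_iff_isLeftDescent _ i).1
    (h₀ _ (cs.isReflection_simple i))).symm

theorem longest_mul_self {B W : Type*} [Group W] {M : CoxeterMatrix B}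
    (cs : CoxeterSystem M W) {w₀ : W} (h₀ : ∀ t, cs.IsReflection t → cs.IsLeftInversion w₀ t) :
    w₀ * w₀ = 1 :=
  eq_inv_iff_mul_eq_one.1 (cs.longest_inv h₀).symm

theorem weakLE_longest {B W : Type*} [Group W] {M : CoxeterMatrix B}
    (cs : CoxeterSystem M W) {w₀ : W} (h₀ : ∀ t, cs.IsReflection t → cs.IsLeftInversion w₀ t)
    (x : W) : cs.WeakLE x w₀ :=
  cs.weakLE_of_mem_closure subset_rfl (fun t _ ht => h₀ t ht)
    (by simp [closure_simpleReflections])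

theorem length_mul_longest {B W : Type*} [Group W] {M : CoxeterMatrix B}
    (cs : CoxeterSystem M W) {w₀ : W} (h₀ : ∀ t, cs.IsReflection t → cs.IsLeftInversion w₀ t)
    (x : W) : cs.length x + cs.length (x * w₀) = cs.length w₀ := by
  simpa using cs.weakLE_iff.1 (cs.weakLE_longest h₀ x⁻¹)

theorem weakLE_mul_longest {B W : Type*} [Group W] {M : CoxeterMatrix B}
    (cs : CoxeterSystem M W) {w₀ : W} (h₀ : ∀ t, cs.IsReflection t → cs.IsLeftInversion w₀ t)
    {x y : W} (h : cs.WeakLE x y) : cs.WeakLE (y * w₀) (x * w₀) := by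
  rw [weakLE_iff] at h ⊢
  -- Two complementations by `w₀` show that this quotient has the length of `x⁻¹ * y`.
  have e : (y * w₀)⁻¹ * (x * w₀) = ((x⁻¹ * y * w₀)⁻¹ * w₀) := by group
  have h1 := cs.length_mul_longest h₀ x
  have h2 := cs.length_mul_longest h₀ y
  have h3 := cs.length_mul_longest h₀ (x⁻¹ * y)
  have h4 := cs.length_mul_longest h₀ (x⁻¹ * y * w₀)⁻¹
  rw [length_inv] at h4
  rw [e]
  omega

theorem isLeftInversion_mul_longest_iff {B W : Type*} [Group W] {M : CoxeterMatrix B}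
    (cs : CoxeterSystem M W) {w₀ : W} (h₀ : ∀ t, cs.IsReflection t → cs.IsLeftInversion w₀ t)
    {x t : W} : cs.IsLeftInversion (x * w₀) t ↔ cs.IsReflection t ∧ ¬ cs.IsLeftInversion x t := by
  constructor
  · intro h
    refine ⟨h.1, fun h' => (cs.isLeftInversion_mul_iff.1 h).1 h' (h₀ _ ?_)⟩
    simpa using h.1.conj x⁻¹
  · rintro ⟨ht, h⟩
    rw [isLeftInversion_mul_iff]
    refine ⟨fun h' => absurd h' h, fun h' => absurd (h₀ _ ?_) h'⟩
    simpa using ht.conj x⁻¹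

theorem parabolicProj_mul_longest {B W : Type*} [Group W] {M : CoxeterMatrix B}
    (cs : CoxeterSystem M W) {K : Set W} (hK : K ⊆ cs.simpleReflections) {w₀ : W}
    (h₀ : ∀ t, cs.IsReflection t → cs.IsLeftInversion w₀ t) {x y : W}
    (h : cs.parabolicProj K x = cs.parabolicProj K y) :
    cs.parabolicProj K (x * w₀) = cs.parabolicProj K (y * w₀) := by
  rw [parabolicProj_eq_iff _ hK] at h ⊢
  intro t ht
  rw [isLeftInversion_mul_longest_iff _ h₀, isLeftInversion_mul_longest_iff _ h₀, h t ht]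

theorem parabolicProj_eq_iff_weakLE {B W : Type*} [Group W] {M : CoxeterMatrix B}
    (cs : CoxeterSystem M W) {K : Set W} (hK : K ⊆ cs.simpleReflections) {x y : W} :
    cs.parabolicProj K x = cs.parabolicProj K y ↔
      ∀ u ∈ Subgroup.closure K, cs.WeakLE u x ↔ cs.WeakLE u y := by
  constructor
  · intro h u hu
    rw [cs.weakLE_iff_weakLE_parabolicProj hK hu, h, ← cs.weakLE_iff_weakLE_parabolicProj hK hu]
  · intro h
    have hx := cs.parabolicProj_mem K x
    have hy := cs.parabolicProj_mem K y
    refine WeakLE.eq_of_length_le (cs := cs) ?_ (WeakLE.length_le (cs := cs) ?_)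
    · rw [← cs.weakLE_iff_weakLE_parabolicProj hK hx, ← h _ hx]
      exact cs.parabolicProj_weakLE K x
    · rw [← cs.weakLE_iff_weakLE_parabolicProj hK hy, h _ hy]
      exact cs.parabolicProj_weakLE K y

/-! ### The lattice and the parabolic congruence -/

/-- The lattice structure on the weak order determined by a meet operation and a longest
element. -/
@[reducible]
def weakLattice {B W : Type*} [Group W] {M : CoxeterMatrix B} (cs : CoxeterSystem M W)
    {w₀ : W} (h₀ : ∀ t, cs.IsReflection t → cs.IsLeftInversion w₀ t) (meet : W → W → W)
    (hmeet : ∀ x y u, cs.WeakLE u (meet x y) ↔ cs.WeakLE u x ∧ cs.WeakLE u y) : Lattice W where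
  toPartialOrder := cs.weakOrder
  inf := meet
  sup x y := meet (x * w₀) (y * w₀) * w₀
  inf_le_left x y := ((hmeet x y _).1 Relation.ReflTransGen.refl).1
  inf_le_right x y := ((hmeet x y _).1 Relation.ReflTransGen.refl).2
  le_inf x y z h h' := (hmeet y z x).2 ⟨h, h'⟩
  le_sup_left x y := by
    have h := cs.weakLE_mul_longest h₀ ((hmeet (x * w₀) (y * w₀) _).1 Relation.ReflTransGen.refl).1
    rwa [mul_assoc, cs.longest_mul_self h₀, mul_one] at h
  le_sup_right x y := by
    have h := cs.weakLE_mul_longest h₀ ((hmeet (x * w₀) (y * w₀) _).1 Relation.ReflTransGen.refl).2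
    rwa [mul_assoc, cs.longest_mul_self h₀, mul_one] at h
  sup_le x y z h h' := by
    have h1 := cs.weakLE_mul_longest h₀ ((hmeet (x * w₀) (y * w₀) _).2
      ⟨cs.weakLE_mul_longest h₀ h, cs.weakLE_mul_longest h₀ h'⟩)
    rwa [mul_assoc z, cs.longest_mul_self h₀, mul_one] at h1

theorem parabolicProj_simple {B W : Type*} [Group W] {M : CoxeterMatrix B}
    (cs : CoxeterSystem M W) {K : Set W} (hK : K ⊆ cs.simpleReflections) {i : B}
    (hi : cs.simple i ∉ K) : cs.parabolicProj K (cs.simple i) = 1 := by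
  rcases (cs.parabolicProj_weakLE K (cs.simple i)).eq_or_length_lt with h | h
  · exact absurd (cs.simple_mem_of_mem_closure hK (h ▸ cs.parabolicProj_mem K _)) hi
  · rwa [length_simple, Nat.lt_one_iff, length_eq_zero_iff] at h

theorem parabolicProj_one {B W : Type*} [Group W] {M : CoxeterMatrix B}
    (cs : CoxeterSystem M W) (K : Set W) : cs.parabolicProj K 1 = 1 := by
  have h := (cs.parabolicProj_weakLE K 1).length_le
  rwa [length_one, Nat.le_zero, length_eq_zero_iff] at h

/-- The lattice congruence on the weak order whose classes are the fibers of the parabolic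
projection. -/
noncomputable def parabolicCon {B W : Type*} [Group W] {M : CoxeterMatrix B} (cs : CoxeterSystem M W)
    {w₀ : W} (h₀ : ∀ t, cs.IsReflection t → cs.IsLeftInversion w₀ t) (meet : W → W → W)
    (hmeet : ∀ x y u, cs.WeakLE u (meet x y) ↔ cs.WeakLE u x ∧ cs.WeakLE u y)
    {K : Set W} (hK : K ⊆ cs.simpleReflections) :
    @LatticeCon W (cs.weakLattice h₀ meet hmeet) :=
  letI := cs.weakLattice h₀ meet hmeet
  have hinf : ∀ {w x y z : W}, cs.parabolicProj K w = cs.parabolicProj K x →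
      cs.parabolicProj K y = cs.parabolicProj K z →
      cs.parabolicProj K (meet w y) = cs.parabolicProj K (meet x z) := by
    intro w x y z h h'
    rw [parabolicProj_eq_iff_weakLE _ hK] at h h' ⊢
    intro u hu
    rw [hmeet, hmeet, h u hu, h' u hu]
  { toSetoid := Setoid.ker (cs.parabolicProj K)
    inf := fun h h' => hinf h h'
    sup := fun h h' => cs.parabolicProj_mul_longest hK h₀ (hinf
      (cs.parabolicProj_mul_longest hK h₀ h) (cs.parabolicProj_mul_longest hK h₀ h')) }

/-- A lattice congruence of the weak order which identifies `1` with every simple reflection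
outside `K` identifies every element with its parabolic projection. -/
theorem latticeCon_parabolicProj {B W : Type*} [Group W] [Finite W] {M : CoxeterMatrix B}
    (cs : CoxeterSystem M W) {K : Set W} (hK : K ⊆ cs.simpleReflections)
    {L : Lattice W} (hL : L.toPartialOrder = cs.weakOrder) (Φ : LatticeCon W)
    (hΦ : ∀ s ∈ cs.simpleReflections \ K, Φ.r 1 s) (w : W) : Φ.r (cs.parabolicProj K w) w := by
  have hle : ∀ x y : W, x ≤ y ↔ cs.WeakLE x y := by
    intro x y
    exact iff_of_eq (congrArg (fun P : PartialOrder W => P.le x y) hL)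
  obtain ⟨w₀, h₀⟩ := cs.exists_longest
  obtain ⟨v₀, hv₀, hinv⟩ := cs.exists_forall_isLeftInversion K
  -- A longest `x ≥ v₀` in the class of `v₀` absorbs joins with every `s` outside `K`, and lies
  -- above every `s` in `K` through `v₀`. It therefore has all left descents and equals `w₀`.
  obtain ⟨x, ⟨hx, hvx⟩, hmax⟩ := Set.exists_max_image {x | Φ.r v₀ x ∧ v₀ ≤ x}
    cs.length (Set.toFinite _) ⟨v₀, Φ.refl v₀, le_rfl⟩
  have hdesc : ∀ i, cs.IsLeftDescent x i := by
    intro i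
    rw [← simple_weakLE_iff, ← hle]
    by_cases hi : cs.simple i ∈ K
    · refine le_trans ?_ hvx
      rw [hle]
      exact cs.weakLE_of_mem_closure hK hinv (Subgroup.subset_closure hi)
    · have h1 : Φ.r (1 ⊔ x) (cs.simple i ⊔ x) := Φ.sup (hΦ _ ⟨⟨i, rfl⟩, hi⟩) (Φ.refl x)
      rw [sup_eq_right.2 ((hle _ _).2 (cs.one_weakLE x))] at h1
      have h2 := hmax (cs.simple i ⊔ x) ⟨Φ.trans hx h1, hvx.trans le_sup_right⟩
      have h3 := ((hle _ _).1 (le_sup_right : x ≤ cs.simple i ⊔ x)).eq_of_length_le h2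
      rw [h3]
      exact le_sup_left
  rw [cs.eq_inv_longest h₀ hdesc, cs.longest_inv h₀] at hx
  have h1 : Φ.r (w ⊓ v₀) (w ⊓ w₀) := Φ.inf (Φ.refl w) hx
  rw [inf_eq_left.2 ((hle _ _).2 (cs.weakLE_longest h₀ w))] at h1
  have h2 : w ⊓ v₀ = cs.parabolicProj K w := by
    apply le_antisymm
    · have hmem : w ⊓ v₀ ∈ Subgroup.closure K :=
        cs.mem_closure_of_weakLE hK hv₀ ((hle _ _).1 inf_le_right)
      rw [hle, ← cs.weakLE_iff_weakLE_parabolicProj hK hmem, ← hle]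
      exact inf_le_left
    · refine le_inf ((hle _ _).2 (cs.parabolicProj_weakLE K w)) ((hle _ _).2 ?_)
      exact cs.weakLE_of_mem_closure hK hinv (cs.parabolicProj_mem K w)
  rwa [h2] at h1

end CoxeterSystem

/-- For a finite Coxeter system `(W, S)` and `K ⊆ S`: the element `w_K` is well defined, the right
weak order on `W` is a lattice, and the fibers of `w ↦ w_K` are the classes of a congruence of this
lattice which is the smallest one satisfying `1 ≡ s` for all `s ∈ S - K`. -/
theorem corollary6p10 {B W : Type*} [Group W] [Finite W] {M : CoxeterMatrix B}
    (cs : CoxeterSystem M W) (K : Set W) (hK : K ⊆ cs.simpleReflections) :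
    (∀ w u : W, cs.IsParabolicFactor K w u ↔ u = cs.parabolicProj K w) ∧
    ∃ L : Lattice W, L.toPartialOrder = cs.weakOrder ∧
      ∃ Θ : LatticeCon W,
        (∀ x y : W, Θ.r x y ↔ cs.parabolicProj K x = cs.parabolicProj K y) ∧
        (∀ s ∈ cs.simpleReflections \ K, Θ.r 1 s) ∧
        ∀ Φ : LatticeCon W, (∀ s ∈ cs.simpleReflections \ K, Φ.r 1 s) →
          Θ.toSetoid ≤ Φ.toSetoid := by
  refine ⟨cs.isParabolicFactor_iff hK, ?_⟩
  obtain ⟨w₀, h₀⟩ := cs.exists_longest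
  choose meet hmeet using cs.exists_weak_meet
  refine ⟨cs.weakLattice h₀ meet hmeet, rfl, cs.parabolicCon h₀ meet hmeet hK,
    fun x y => Iff.rfl, ?_, ?_⟩
  · rintro _ ⟨⟨i, rfl⟩, hi⟩
    change cs.parabolicProj K 1 = cs.parabolicProj K (cs.simple i)
    rw [cs.parabolicProj_one, cs.parabolicProj_simple hK hi]
  · intro Φ hΦ x y hxy
    have hxy' : cs.parabolicProj K x = cs.parabolicProj K y := hxy
    have h1 := cs.latticeCon_parabolicProj hK (L := cs.weakLattice h₀ meet hmeet) rfl Φ hΦ x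
    have h2 := cs.latticeCon_parabolicProj hK (L := cs.weakLattice h₀ meet hmeet) rfl Φ hΦ y
    rw [hxy'] at h1
    exact Φ.trans (Φ.symm h1) h2
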